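/- Let $f\in\mathbb{C}[[t]]$ be a compositionally invertible formal power series, i.e. $f(0)=0$ and $f'(0)\neq 0$. A fractional iteration of $f$ is a family $(f^s)_{s\in\mathbb{C}}$ of formal power series with zero constant term such that $f^1=f$, $f^r\circ f^s=f^{r+s}$ for all $r,s\in\mathbb{C}$, and every coefficient of $f^s$ is complex differentiable in $s$ at $s=0$; the corresponding iterative logarithm is the formal power series $$\operatorname{itlog}(f):=\frac{d}{ds}f^s\Big|_{s=0},$$ the derivative being taken coefficientwise. Let $\mathbf{x}$ and $D$ be the operators of multiplication by $x$ and of differentiation on $\mathbb{C}[x]$; for $V=\sum_k v_kt^k\in\mathbb{C}[[t]]$ put $V(D)=\sum_k v_kD^k$. The umbral operator generated by $f$ is the linear operator $\phi$ on $\mathbb{C}[x]$ with $$\sum_{n\ge 0}\phi(x^n)\frac{t^n}{n!}=e^{xf(t)}.$$ Then: (i) Let $\ell\in\mathbb{C}$ with $e^{\ell}=f'(0)$, and suppose that $\ell=0$ or that $f'(0)$ is not a root of unity. Then there is exactly one fractional iteration $(f^s)_{s\in\mathbb{C}}$ of $f$ with $(f^s)'(0)=e^{\ell s}$ for all $s\in\mathbb{C}$.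 (ii) For every fractional iteration $(f^s)_{s\in\mathbb{C}}$ of $f$, with corresponding iterative logarithm $\operatorname{itlog}(f)$, the umbral operator $\phi$ generated by $f$ is $$\phi=e^{\mathbf{x}\,\operatorname{itlog}(f)(D)}=\sum_{k=0}^\infty\frac{1}{k!}\bigl(\mathbf{x}\,\operatorname{itlog}(f)(D)\bigr)^k,$$ meaning that for every $p\in\mathbb{C}[x]$ the series applied to $p$ converges, coefficient by coefficient, to $\phi p$. -/

import Mathlib

namespace UmbralIteration

noncomputable section

/-- The family `F s` (`s : ℂ`) is a fractional iteration `s ↦ f^s` of the formal power series `f`: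
every `f^s` has zero constant term (so that composition makes sense), `f^1 = f`,
`f^r ∘ f^s = f^(r+s)`, and `s ↦ f^s` is (coefficientwise) complex differentiable at `s = 0`.
Here `(F r).subst (F s)` is the composite `F r ∘ F s`. -/
structure IsFractionalIteration (f : PowerSeries ℂ) (F : ℂ → PowerSeries ℂ) : Prop where
  constantCoeff_eq_zero : ∀ s, PowerSeries.constantCoeff (F s) = 0
  one : F 1 = f
  comp : ∀ r s, (F r).subst (F s) = F (r + s)
  differentiableAt_zero : ∀ n, DifferentiableAt ℂ (fun s => PowerSeries.coeff n (F s)) 0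

/-- The iterative logarithm `d/ds f^s` at `s = 0`, taken coefficientwise, of `f`
with fractional iterates `f^s = F s`. -/
def itlog (F : ℂ → PowerSeries ℂ) : PowerSeries ℂ :=
  PowerSeries.mk fun n => deriv (fun s => PowerSeries.coeff n (F s)) 0

/-- On a polynomial `p` only the terms `k ≤ deg p` of `∑ k, v_k D^k p` are nonzero. -/
theorem sum_derivative_eq (V : PowerSeries ℂ) (p : Polynomial ℂ) {N : ℕ} (h : p.natDegree < N) :
    ∑ k ∈ Finset.range (p.natDegree + 1), PowerSeries.coeff k V • Polynomial.derivative^[k] p =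
      ∑ k ∈ Finset.range N, PowerSeries.coeff k V • Polynomial.derivative^[k] p := by
  refine Finset.sum_subset (Finset.range_mono h) fun k _ hk => ?_
  rw [Polynomial.iterate_derivative_eq_zero (by simpa using hk), smul_zero]

/-- The operator `V(D) = ∑ k, v_k D^k` on polynomials, for a formal power series
`V = ∑ k, v_k t^k`, where `D` is the derivative. -/
def evalD (V : PowerSeries ℂ) : Module.End ℂ (Polynomial ℂ) where
  toFun p := ∑ k ∈ Finset.range (p.natDegree + 1),
    PowerSeries.coeff k V • Polynomial.derivative^[k] p
  map_add' p q := by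
    have hN := Polynomial.natDegree_add_le p q
    rw [sum_derivative_eq V (p + q) (N := max p.natDegree q.natDegree + 1) (by omega),
      sum_derivative_eq V p (N := max p.natDegree q.natDegree + 1) (by omega),
      sum_derivative_eq V q (N := max p.natDegree q.natDegree + 1) (by omega),
      ← Finset.sum_add_distrib]
    simp only [iterate_map_add, smul_add]
  map_smul' c p := by
    have hN := Polynomial.natDegree_smul_le c p
    rw [sum_derivative_eq V (c • p) (N := p.natDegree + 1) (by omega), RingHom.id_apply,
      Finset.smul_sum]
    simp only [Polynomial.iterate_derivative_smul, smul_comm c]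

/-- The operator `𝐱` of multiplication by `x` on polynomials. -/
def mulX : Module.End ℂ (Polynomial ℂ) := LinearMap.mulLeft ℂ Polynomial.X

/-- The generating function `∑ n, U(x^n) t^n / n!` of an operator `U` on polynomials,
as a formal power series in `t` with coefficients in `ℂ[x]`. -/
def genFun (U : Module.End ℂ (Polynomial ℂ)) : PowerSeries (Polynomial ℂ) :=
  PowerSeries.mk fun n => ((n.factorial : ℂ)⁻¹) • U (Polynomial.X ^ n)

/-- The formal power series `e^{x f(t)}` in `t` with coefficients in `ℂ[x]`. -/
def expXMul (f : PowerSeries ℂ) : PowerSeries (Polynomial ℂ) :=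
  (PowerSeries.exp ℂ).subst
    (PowerSeries.C (Polynomial.X : Polynomial ℂ) * PowerSeries.map Polynomial.C f)

/-- `φ` is the umbral operator generated by the (compositionally invertible) series `f`. -/
def IsUmbralOperator (f : PowerSeries ℂ) (φ : Module.End ℂ (Polynomial ℂ)) : Prop :=
  genFun φ = expXMul f

/-- `φ = e^A = ∑ k, A^k / k!`: for every polynomial `p`, the series `∑ k, A^k p / k!` converges
coefficientwise to `φ p`. -/
def IsOperatorExp (A φ : Module.End ℂ (Polynomial ℂ)) : Prop :=
  ∀ (p : Polynomial ℂ) (n : ℕ),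
    HasSum (fun k : ℕ => (((k.factorial : ℂ)⁻¹) • (A ^ k) p).coeff n) ((φ p).coeff n)

end

end UmbralIteration

/-!
A fractional iteration of `f` turns composition into a one-parameter group, and all the assertions
come from its triangular structure.

**Uniqueness.** The coefficient of `t^n` in `f^r ∘ f^s` is
`e^{lr} [t^n] f^s + e^{nls} [t^n] f^r` plus terms of lower degree. Hence at the first degree where
two fractional iterations with the same multipliers could differ, the difference `d` satisfies
`d(r + s) = e^{lr} d(s) + e^{nls} d(r)` and `d(1) = 0`. If `l = 0`, then `d` is additive and
differentiable at `0`, so it is linear and vanishes; if `e^l` is not a root of unity, comparing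
`d(1 + s)` with `d(s + 1)` gives `d = 0` (`IsFractionalIteration.eq_of_coeff_one_eq`).

**Existence.** If `f'(0)` is not a root of unity, the triangular system for a series `σ` with
`σ ∘ f = f'(0) σ` has nonzero diagonal entries, and `f^s = σ⁻¹ ∘ (e^{ls} σ)`
(`exists_linearization`, `exists_isFractionalIteration_of_linearization`). If `f'(0) = 1`, the
operator `T g = g ∘ f` differs from the identity by an operator that raises the order, so
`f^s = ∑ j, (s choose j) (T - 1)^j t` is a finite sum in each degree. Its coefficients are polynomials
in `s`, and the group law follows from the one for natural exponents
(`exists_isFractionalIteration_of_coeff_one_eq_one`).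

**The umbral operator.** The matrices `[t^n] (f^s)^k`, truncated at any size, form a one-parameter
group in `s` which is differentiable at `0`. Its generator is the matrix of the derivation
`itlog(f)(t) d/dt`, so that the matrix at `s = 1` is the exponential of this generator
(`IsFractionalIteration.hasSum_coeff_pow`). With row index `k` and column index `n`, the two matrices
represent in the basis `x^k / k!` of `ℂ[x]` the umbral operator (`IsUmbralOperator.coeff_apply`) and `𝐱 itlog(f)(D)`
(`coeff_mulX_evalD`). As `itlog(f)` has no constant term, the latter does not raise degrees, and
the truncation is harmless.
-/

namespace UmbralIteration

noncomputable section

open PowerSeries Finset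

/-! ### Coefficients of powers and of composites -/

theorem X_pow_dvd_pow {R : Type*} [CommRing R] {a : R⟦X⟧} (ha : constantCoeff a = 0) (k : ℕ) :
    (X : R⟦X⟧) ^ k ∣ a ^ k :=
  pow_dvd_pow_of_dvd (X_dvd_iff.mpr ha) k

theorem coeff_pow_eq_zero {R : Type*} [CommRing R] {a : R⟦X⟧} (ha : constantCoeff a = 0)
    {n k : ℕ} (h : n < k) : coeff n (a ^ k) = 0 :=
  X_pow_dvd_iff.mp (X_pow_dvd_pow ha k) n h

theorem coeff_pow_self {R : Type*} [CommRing R] {a : R⟦X⟧} (ha : constantCoeff a = 0) (n : ℕ) :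
    coeff n (a ^ n) = coeff 1 a ^ n := by
  obtain ⟨u, rfl⟩ := X_dvd_iff.mpr ha
  have h := coeff_X_pow_mul (u ^ n) n 0
  have h' := coeff_succ_X_mul 0 u
  rw [zero_add] at h h'
  rw [mul_pow, h, h']
  simp

/-- The composite `g ∘ a` has coefficients given by finite sums, and any bound `N ≥ n` on the
summation range will do. -/
theorem coeff_subst_eq_sum {R S : Type*} [CommRing R] [CommRing S] [Algebra R S] {a : S⟦X⟧}
    (ha : constantCoeff a = 0) (g : R⟦X⟧) {n N : ℕ} (h : n ≤ N) :
    coeff n (g.subst a) = ∑ k ∈ range (N + 1), coeff k g • coeff n (a ^ k) := by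
  rw [coeff_subst' (HasSubst.of_constantCoeff_zero' ha)]
  refine finsum_eq_sum_of_support_subset _ fun k hk => ?_
  rw [Function.mem_support] at hk
  by_contra hkN
  exact hk (by rw [coeff_pow_eq_zero ha (by simp at hkN; omega), smul_zero])

theorem constantCoeff_subst_eq {a g : ℂ⟦X⟧} (ha : constantCoeff a = 0) :
    constantCoeff (g.subst a) = constantCoeff g := by
  have := coeff_subst_eq_sum ha g (le_refl 0)
  simpa using this

theorem coeff_one_subst {a g : ℂ⟦X⟧} (ha : constantCoeff a = 0) :
    coeff 1 (g.subst a) = coeff 1 g * coeff 1 a := by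
  rw [coeff_subst_eq_sum ha g (le_refl 1)]
  simp [sum_range_succ, coeff_one]

theorem subst_assoc {a b : ℂ⟦X⟧} (ha : constantCoeff a = 0) (hb : constantCoeff b = 0)
    (g : ℂ⟦X⟧) : PowerSeries.subst b (g.subst a) = g.subst (a.subst b) :=
  PowerSeries.subst_comp_subst_apply (HasSubst.of_constantCoeff_zero' ha)
    (HasSubst.of_constantCoeff_zero' hb) g

/-- If two series without constant term agree below degree `n`, their powers with exponent at
least two agree up to and including degree `n`. -/
theorem coeff_pow_congr {a b : ℂ⟦X⟧} (ha : constantCoeff a = 0) (hb : constantCoeff b = 0)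
    {n : ℕ} (h : ∀ m < n, coeff m a = coeff m b) {k : ℕ} (hk : 2 ≤ k) :
    coeff n (a ^ k) = coeff n (b ^ k) := by
  have key : ∀ j, (X : ℂ⟦X⟧) ^ (n + j) ∣ a ^ (j + 1) - b ^ (j + 1) := by
    have h0 : (X : ℂ⟦X⟧) ^ n ∣ a - b := X_pow_dvd_iff.mpr fun m hm => by
      rw [map_sub, h m hm, sub_self]
    intro j
    induction j with
    | zero => simpa using h0
    | succ j ih =>
      have e : a ^ (j + 1 + 1) - b ^ (j + 1 + 1)
          = (a - b) * a ^ (j + 1) + (a ^ (j + 1) - b ^ (j + 1)) * b := by ring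
      rw [e]
      refine dvd_add ?_ ?_
      · rw [pow_add]; exact mul_dvd_mul h0 (X_pow_dvd_pow ha _)
      · rw [← add_assoc, pow_succ]; exact mul_dvd_mul ih (X_dvd_iff.mpr hb)
  obtain ⟨j, rfl⟩ : ∃ j, k = j + 1 := ⟨k - 1, by omega⟩
  rw [← sub_eq_zero, ← map_sub]
  exact X_pow_dvd_iff.mp (key j) n (by omega)

/-- A series `f` with `f(0) = 0` and `f'(0) ≠ 0` has a two-sided compositional inverse. -/
theorem exists_compInverse {f : ℂ⟦X⟧} (h0 : constantCoeff f = 0) (h1 : coeff 1 f ≠ 0) :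
    ∃ g : ℂ⟦X⟧, constantCoeff g = 0 ∧ f.subst g = X ∧ g.subst f = X :=
  ⟨substInvOfIsUnit f h1.isUnit, constantCoeff_substInvOfIsUnit _ _,
    subst_substInvOfIsUnit_right _ h0 _, subst_substInvOfIsUnit_left _ h0 _⟩

/-! ### Uniqueness of fractional iterations -/

/-- Two fractional iterations of `f` with the same multipliers `e^{ls}` agree. At the first degree
`n` where they might differ, the difference `d(s)` of the coefficients satisfies
`d(r + s) = e^{lr} d(s) + e^{nls} d(r)` and `d(1) = 0`. If `l = 0`, then `d` is additive and
differentiable at `0`, hence linear; otherwise exchanging `r` and `s` at `r = 1` gives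
`(e^l - e^{nl}) d(s) = 0`. -/
theorem IsFractionalIteration.eq_of_coeff_one_eq {f : ℂ⟦X⟧} {F G : ℂ → ℂ⟦X⟧} {l : ℂ}
    (hl : l = 0 ∨ ∀ n : ℕ, 1 ≤ n → Complex.exp l ^ n ≠ 1)
    (hF : IsFractionalIteration f F) (hG : IsFractionalIteration f G)
    (hF1 : ∀ s, coeff 1 (F s) = Complex.exp (l * s))
    (hG1 : ∀ s, coeff 1 (G s) = Complex.exp (l * s)) : F = G := by
  suffices H : ∀ n s, coeff n (F s) = coeff n (G s) from
    funext fun s => PowerSeries.ext fun n => H n s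
  intro n
  induction n using Nat.strong_induction_on with
  | _ n ih =>
  rcases Nat.lt_or_ge n 2 with hn | hn
  · intro s
    interval_cases n
    · simp [hF.constantCoeff_eq_zero, hG.constantCoeff_eq_zero]
    · rw [hF1, hG1]
  set d : ℂ → ℂ := fun s => coeff n (F s) - coeff n (G s) with hd
  have hadd : ∀ r s, d (r + s) = Complex.exp (l * r) * d s + Complex.exp (n * (l * s)) * d r := by
    intro r s
    obtain ⟨m, rfl⟩ : ∃ m, n = m + 2 := ⟨n - 2, by omega⟩
    have hmid : ∀ k ∈ range m, coeff (k + 2) (F r) * coeff (m + 2) (F s ^ (k + 2)) =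
        coeff (k + 2) (G r) * coeff (m + 2) (G s ^ (k + 2)) := fun k hk => by
      rw [ih (k + 2) (by simp at hk; omega), coeff_pow_congr (hF.constantCoeff_eq_zero s)
        (hG.constantCoeff_eq_zero s) (fun j hj => ih j hj s) (by omega)]
    have hexp : ∀ {H : ℂ → ℂ⟦X⟧}, IsFractionalIteration f H →
        (∀ s, coeff 1 (H s) = Complex.exp (l * s)) → coeff (m + 2) (H (r + s)) =
          ∑ k ∈ range m, coeff (k + 2) (H r) * coeff (m + 2) (H s ^ (k + 2))
          + Complex.exp (l * r) * coeff (m + 2) (H s)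
          + coeff (m + 2) (H r) * Complex.exp ((m + 2 : ℕ) * (l * s)) := by
      intro H hH hH1
      rw [← hH.comp r s, coeff_subst_eq_sum (hH.constantCoeff_eq_zero s) _ (le_refl (m + 2)),
        sum_range_succ, coeff_pow_self (hH.constantCoeff_eq_zero s), sum_range_succ',
        sum_range_succ', hH1, Complex.exp_nat_mul]
      simp [hH.constantCoeff_eq_zero, hH1]
    simp only [hd]
    rw [hexp hF hF1, hexp hG hG1, sum_congr rfl hmid]
    ring
  have hd1 : d 1 = 0 := by simp [hd, hF.one, hG.one]
  suffices H : ∀ s, d s = 0 from fun s => sub_eq_zero.mp (H s)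
  rcases hl with rfl | hl
  · simp only [zero_mul, mul_zero, Complex.exp_zero, one_mul] at hadd
    have hdd : DifferentiableAt ℂ d 0 :=
      (hF.differentiableAt_zero n).sub (hG.differentiableAt_zero n)
    have hderiv : ∀ s, HasDerivAt d (deriv d 0) s := fun s => by
      have h := hdd.hasDerivAt
      rw [← sub_self s] at h
      have h2 := (h.comp_sub_const s s).add_const (d s)
      rw [sub_self] at h2
      refine h2.congr_of_eventuallyEq (Filter.Eventually.of_forall fun t => ?_)
      have := hadd s (t - s)
      rw [add_sub_cancel] at this
      exact this
    have hlin : ∀ s, d s = deriv d 0 * s := by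
      have hg : ∀ s, HasDerivAt (fun s => d s - deriv d 0 * s) 0 s := fun s => 
        ((hderiv s).sub ((hasDerivAt_id s).const_mul (deriv d 0))).congr_deriv (by simp)
      intro s
      have h := is_const_of_deriv_eq_zero (fun s => (hg s).differentiableAt)
        (fun s => (hg s).deriv) s 0
      have h0 : d 0 = 0 := by simpa using hadd 0 0
      simp only [h0, mul_zero, sub_zero] at h
      exact sub_eq_zero.mp h
    have hz : deriv d 0 = 0 := by simpa [hd1] using (hlin 1).symm
    intro s
    rw [hlin s, hz, zero_mul]
  · intro s
    have h1 := hadd 1 s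
    have h2 := hadd s 1
    rw [add_comm, h1, hd1] at h2
    simp only [mul_one, mul_zero, add_zero, zero_add, Complex.exp_nat_mul] at h2
    have h3 : Complex.exp l * (Complex.exp l ^ (n - 1) - 1) * d s = 0 := by
      obtain ⟨m, rfl⟩ : ∃ m, n = m + 1 := ⟨n - 1, by omega⟩
      rw [pow_succ] at h2
      simp only [Nat.add_sub_cancel]
      linear_combination -h2
    rcases mul_eq_zero.mp h3 with h | h
    · exact absurd h (mul_ne_zero (Complex.exp_ne_zero l)
        (sub_ne_zero.mpr (hl (n - 1) (by omega))))
    · exact h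

/-! ### Existence of fractional iterations: linearizable series -/

/-- The solution of a triangular linear system with diagonal entries `d n`, off-diagonal entries
`a n k` and right-hand side `b n`, by forward substitution. -/
def triangularSolution (d : ℕ → ℂ) (a : ℕ → ℕ → ℂ) (b : ℕ → ℂ) (n : ℕ) : ℂ :=
  (b n - ∑ k : Fin n, a n k * triangularSolution d a b k) / d n

theorem triangularSolution_spec {d : ℕ → ℂ} (a : ℕ → ℕ → ℂ) (b : ℕ → ℂ) {n : ℕ} (hd : d n ≠ 0) :
    ∑ k ∈ range n, a n k * triangularSolution d a b k + d n * triangularSolution d a b n = b n := by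
  rw [triangularSolution.eq_def d a b n, mul_div_cancel₀ _ hd,
    Fin.sum_univ_eq_sum_range (fun k => a n k * triangularSolution d a b k) n]
  ring

/-- A series whose multiplier `f'(0)` is not a root of unity is formally linearizable. -/
theorem exists_linearization {f : ℂ⟦X⟧} (h0 : constantCoeff f = 0) (h1 : coeff 1 f ≠ 0)
    (hroot : ∀ n : ℕ, 1 ≤ n → coeff 1 f ^ n ≠ 1) :
    ∃ σ : ℂ⟦X⟧, constantCoeff σ = 0 ∧ coeff 1 σ = 1 ∧ σ.subst f = coeff 1 f • σ := by
  -- The equations in degrees `0` and `1` are replaced by the normalization of `σ`.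
  set d : ℕ → ℂ := fun n => if n < 2 then 1 else coeff 1 f ^ n - coeff 1 f with hd
  set a : ℕ → ℕ → ℂ := fun n k => if n < 2 then 0 else coeff n (f ^ k) with ha
  set b : ℕ → ℂ := fun n => if n = 1 then 1 else 0 with hb
  set c := triangularSolution d a b with hc
  have hc0 : c 0 = 0 := by
    have h := triangularSolution_spec (d := d) a b (n := 0) (by simp [hd])
    rw [← hc] at h
    simpa [hd, ha, hb] using h
  have hc1 : c 1 = 1 := by
    have h := triangularSolution_spec (d := d) a b (n := 1) (by simp [hd])
    rw [← hc] at h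
    simpa [hd, ha, hb] using h
  refine ⟨PowerSeries.mk c, by simpa using hc0, by simpa using hc1, ?_⟩
  ext n
  rw [coeff_subst_eq_sum h0 _ (le_refl n)]
  rcases Nat.lt_or_ge n 2 with hn | hn
  · interval_cases n
    · simp [hc0]
    · simp [sum_range_succ, hc0, hc1]
  · have hdn : d n ≠ 0 := by
      obtain ⟨m, rfl⟩ : ∃ m, n = m + 1 := ⟨n - 1, by omega⟩
      have : coeff 1 f * (coeff 1 f ^ m - 1) ≠ 0 :=
        mul_ne_zero h1 (sub_ne_zero.mpr (hroot m (by omega)))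
      simp only [hd, if_neg (not_lt.mpr hn)]
      rwa [pow_succ', ← mul_sub_one]
    have h := triangularSolution_spec (d := d) a b hdn
    rw [← hc] at h
    simp only [ha, hd, hb, if_neg (not_lt.mpr hn), if_neg (show n ≠ 1 by omega)] at h
    rw [sum_range_succ, coeff_pow_self h0]
    simp only [coeff_mk, smul_eq_mul, coeff_smul]
    rw [sum_congr rfl fun k _ => mul_comm (c k) _]
    linear_combination h

/-- A linearizable series embeds in the one-parameter group `σ⁻¹ ∘ (e^{ls} σ)`. -/
theorem exists_isFractionalIteration_of_linearization {f σ : ℂ⟦X⟧} {l : ℂ}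
    (hσ0 : constantCoeff σ = 0) (hσ1 : coeff 1 σ = 1) (hf0 : constantCoeff f = 0)
    (hσ : σ.subst f = Complex.exp l • σ) :
    ∃ F : ℂ → ℂ⟦X⟧, IsFractionalIteration f F ∧ ∀ s, coeff 1 (F s) = Complex.exp (l * s) := by
  obtain ⟨τ, hτ0, hστ, hτσ⟩ := exists_compInverse hσ0 (by rw [hσ1]; exact one_ne_zero)
  have hs0 : ∀ c : ℂ, constantCoeff (c • σ) = 0 := fun c => by
    rw [smul_eq_C_mul, map_mul, hσ0, mul_zero]
  have hF0 : ∀ c : ℂ, constantCoeff (τ.subst (c • σ)) = 0 := fun c => by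
    rw [constantCoeff_subst_eq (hs0 c), hτ0]
  have hτ1 : coeff 1 τ = 1 := by
    have := coeff_one_subst (g := τ) hσ0
    rw [hτσ, hσ1, mul_one, coeff_one_X] at this
    exact this.symm
  refine ⟨fun s => τ.subst (Complex.exp (l * s) • σ), ⟨fun s => hF0 _, ?_, ?_, ?_⟩, ?_⟩
  · simp only [mul_one]
    rw [← hσ, ← subst_assoc hσ0 hf0, hτσ, subst_X (HasSubst.of_constantCoeff_zero' hf0)]
  · intro r s
    have e : ∀ c d : ℂ, (c • σ).subst (τ.subst (d • σ)) = (c * d) • σ := fun c d => by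
      rw [subst_smul (HasSubst.of_constantCoeff_zero' (hF0 d)), ← subst_assoc hτ0 (hs0 d), hστ,
        subst_X (HasSubst.of_constantCoeff_zero' (hs0 d)), smul_smul]
    rw [subst_assoc (hs0 _) (hF0 _), e, ← Complex.exp_add, ← mul_add]
  · intro n
    have e : (fun s => coeff n (τ.subst (Complex.exp (l * s) • σ))) = fun s =>
        ∑ k ∈ range (n + 1), coeff k τ * (Complex.exp (l * s) ^ k * coeff n (σ ^ k)) := by
      funext s
      rw [coeff_subst_eq_sum (hs0 _) _ (le_refl n)]
      simp only [smul_pow, coeff_smul, smul_eq_mul]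
    rw [e]
    fun_prop
  · intro s
    rw [coeff_one_subst (hs0 _), hτ1, coeff_smul, hσ1]
    simp

/-! ### Existence of fractional iterations: multiplier one -/

/-- The composition operator `g ↦ g ∘ f` on formal power series. -/
def compOp (f : ℂ⟦X⟧) (hf : constantCoeff f = 0) : Module.End ℂ ℂ⟦X⟧ :=
  (substAlgHom (R := ℂ) (HasSubst.of_constantCoeff_zero' hf)).toLinearMap

theorem compOp_apply {f : ℂ⟦X⟧} (hf : constantCoeff f = 0) (g : ℂ⟦X⟧) :
    compOp f hf g = g.subst f :=
  congrFun (coe_substAlgHom (R := ℂ) (HasSubst.of_constantCoeff_zero' hf)) g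

/-- If `f` is tangent to the identity, then `g ↦ g ∘ f - g` raises the order of `g`. -/
theorem X_pow_succ_dvd_compOp_sub_one {f : ℂ⟦X⟧} (hf : constantCoeff f = 0) (hf1 : coeff 1 f = 1)
    {g : ℂ⟦X⟧} {n : ℕ} (hg : (X : ℂ⟦X⟧) ^ n ∣ g) : X ^ (n + 1) ∣ (compOp f hf - 1) g := by
  rw [X_pow_dvd_iff] at hg ⊢
  intro m hm
  rw [LinearMap.sub_apply, compOp_apply, Module.End.one_apply, map_sub,
    coeff_subst_eq_sum hf g (le_refl m), sum_range_succ, coeff_pow_self hf, hf1, one_pow,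
    sum_eq_zero fun k hk => ?_]
  · simp
  · rw [hg k (by simp at hk; omega), zero_smul]

theorem coeff_compOp_sub_one_pow {f : ℂ⟦X⟧} (hf : constantCoeff f = 0) (hf1 : coeff 1 f = 1)
    (g : ℂ⟦X⟧) {n j : ℕ} (h : n < j) : coeff n (((compOp f hf - 1) ^ j) g) = 0 := by
  have : ∀ j, (X : ℂ⟦X⟧) ^ j ∣ ((compOp f hf - 1) ^ j) g := fun j => by
    induction j with
    | zero => simp
    | succ j ih =>
      rw [pow_succ' (compOp f hf - 1), Module.End.mul_apply]
      exact X_pow_succ_dvd_compOp_sub_one hf hf1 ih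
  exact X_pow_dvd_iff.mp (this j) n h

/-- The generic iterate: a power series in `t` whose coefficients are polynomials in the iteration
parameter `s`, namely `∑ j, (s choose j) (T - 1)^j t`, where `T g = g ∘ f`. -/
def genericIterate (f : ℂ⟦X⟧) (hf : constantCoeff f = 0) : PowerSeries (Polynomial ℂ) :=
  PowerSeries.mk fun n => ∑ j ∈ range (n + 1),
    Polynomial.C (coeff n (((compOp f hf - 1) ^ j) X) * (j.factorial : ℂ)⁻¹) *
      descPochhammer ℂ j

/-- The specialization of the generic iterate at the parameter `s`. -/
def iterate (f : ℂ⟦X⟧) (hf : constantCoeff f = 0) (s : ℂ) : ℂ⟦X⟧ :=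
  PowerSeries.map (Polynomial.evalRingHom s) (genericIterate f hf)

theorem coeff_iterate_pow {f : ℂ⟦X⟧} (hf : constantCoeff f = 0) (s : ℂ) (n k : ℕ) :
    coeff n (iterate f hf s ^ k) = (coeff n (genericIterate f hf ^ k)).eval s := by
  rw [iterate, ← map_pow, coeff_map, Polynomial.coe_evalRingHom]

/-- At natural numbers the iterate is the genuine one, by Newton's binomial formula for
`T = 1 + (T - 1)`. -/
theorem iterate_natCast {f : ℂ⟦X⟧} (hf : constantCoeff f = 0) (hf1 : coeff 1 f = 1) (m : ℕ) :
    iterate f hf m = ((compOp f hf) ^ m) X := by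
  ext n
  have hT : compOp f hf ^ m = ((compOp f hf - 1) + 1) ^ m := by rw [sub_add_cancel]
  rw [hT, (Commute.one_right _).add_pow]
  simp only [one_pow, mul_one, LinearMap.sum_apply, map_sum]
  have hterm : ∀ j, coeff n (((compOp f hf - 1) ^ j * (m.choose j : Module.End ℂ ℂ⟦X⟧)) X) =
      (m.choose j : ℂ) * coeff n (((compOp f hf - 1) ^ j) X) := fun j => by
    rw [← nsmul_eq_mul', LinearMap.smul_apply, map_nsmul, nsmul_eq_mul]
  simp only [hterm]
  have hlhs : coeff n (iterate f hf m) = ∑ j ∈ range (n + 1),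
      (m.choose j : ℂ) * coeff n (((compOp f hf - 1) ^ j) X) := by
    simp only [iterate, coeff_map, genericIterate, coeff_mk, map_sum, Polynomial.coe_evalRingHom,
      Polynomial.eval_mul, Polynomial.eval_C, descPochhammer_eval_eq_descFactorial,
      Nat.descFactorial_eq_factorial_mul_choose, Nat.cast_mul]
    refine sum_congr rfl fun j _ => ?_
    have : (j.factorial : ℂ) ≠ 0 := Nat.cast_ne_zero.mpr j.factorial_ne_zero
    field_simp
  -- Both sums have the same nonzero terms: those with `j ≤ n` and `j ≤ m`.
  rw [hlhs]
  trans ∑ j ∈ range (max n m + 1), (m.choose j : ℂ) * coeff n (((compOp f hf - 1) ^ j) X)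
  · refine sum_subset (range_mono (by omega)) fun j _ hj => ?_
    rw [coeff_compOp_sub_one_pow hf hf1 _ (by simp at hj; omega), mul_zero]
  · refine (sum_subset (range_mono (by omega)) fun j _ hj => ?_).symm
    rw [Nat.choose_eq_zero_of_lt (by simp at hj; omega), Nat.cast_zero, zero_mul]

/-- The `m`-th power of the composition operator is composition with the `m`-th iterate, which is
the image of `X`. -/
theorem compOp_pow_apply {f : ℂ⟦X⟧} (hf : constantCoeff f = 0) (m : ℕ) :
    constantCoeff (((compOp f hf) ^ m) X) = 0 ∧
      ∀ g : ℂ⟦X⟧, ((compOp f hf) ^ m) g = g.subst (((compOp f hf) ^ m) X) := by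
  induction m with
  | zero => simp [X_subst]
  | succ m ih =>
    simp only [pow_succ', Module.End.mul_apply, compOp_apply]
    refine ⟨by rw [constantCoeff_subst_eq hf, ih.1], fun g => ?_⟩
    rw [← subst_assoc ih.1 hf, ← ih.2]

theorem polynomial_eq_of_natCast {P Q : Polynomial ℂ}
    (h : ∀ m : ℕ, P.eval (m : ℂ) = Q.eval (m : ℂ)) : P = Q :=
  Polynomial.eq_of_infinite_eval_eq P Q <|
    (Set.infinite_range_of_injective (Nat.cast_injective (R := ℂ))).mono <| by
      rintro _ ⟨m, rfl⟩
      exact h m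

/-- A series tangent to the identity embeds in the one-parameter group of its binomial iterates:
the group law is polynomial in both parameters, so it holds for complex parameters because it holds
for natural ones. -/
theorem exists_isFractionalIteration_of_coeff_one_eq_one {f : ℂ⟦X⟧} (hf : constantCoeff f = 0)
    (hf1 : coeff 1 f = 1) :
    ∃ F : ℂ → ℂ⟦X⟧, IsFractionalIteration f F ∧ ∀ s, coeff 1 (F s) = 1 := by
  have hcoeff : ∀ n s, coeff n (iterate f hf s) = (coeff n (genericIterate f hf)).eval s :=
    fun n s => by simpa using coeff_iterate_pow hf s n 1
  have h0 : ∀ s, constantCoeff (iterate f hf s) = 0 := fun s => by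
    rw [← coeff_zero_eq_constantCoeff_apply, hcoeff]
    simp [genericIterate]
  refine ⟨iterate f hf, ⟨h0, ?_, ?_, ?_⟩, ?_⟩
  · have := iterate_natCast hf hf1 1
    rw [Nat.cast_one, pow_one, compOp_apply, subst_X (HasSubst.of_constantCoeff_zero' hf)] at this
    exact this
  · intro r s
    ext n
    -- Both sides are polynomial in `r` and in `s`, and they agree for natural `r` and `s`.
    set P := genericIterate f hf with hP
    have hsub : ∀ r s, coeff n ((iterate f hf r).subst (iterate f hf s)) =
        ∑ k ∈ range (n + 1), (coeff k P).eval r * (coeff n (P ^ k)).eval s := fun r s => by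
      rw [coeff_subst_eq_sum (h0 s) _ (le_refl n)]
      simp only [hcoeff, coeff_iterate_pow, smul_eq_mul, hP]
    have hnat : ∀ a b : ℕ, coeff n ((iterate f hf a).subst (iterate f hf b)) =
        coeff n (iterate f hf (a + b)) := fun a b => by
      rw [← Nat.cast_add, iterate_natCast hf hf1, iterate_natCast hf hf1, iterate_natCast hf hf1,
        ← (compOp_pow_apply hf b).2, ← Module.End.mul_apply, ← pow_add, add_comm]
    have step1 : ∀ (a : ℕ) (s : ℂ), coeff n ((iterate f hf a).subst (iterate f hf s)) =
        coeff n (iterate f hf (a + s)) := fun a s => by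
      have := polynomial_eq_of_natCast
        (P := ∑ k ∈ range (n + 1), Polynomial.C ((coeff k P).eval (a : ℂ)) * coeff n (P ^ k))
        (Q := (coeff n P).comp (Polynomial.C (a : ℂ) + Polynomial.X)) fun b => by
          have := hnat a b
          rw [hsub, hcoeff] at this
          simpa [Polynomial.eval_finsetSum] using this
      have := congrArg (Polynomial.eval s) this
      rw [hsub, hcoeff]
      simpa [Polynomial.eval_finsetSum] using this
    have := polynomial_eq_of_natCast
      (P := ∑ k ∈ range (n + 1), coeff k P * Polynomial.C ((coeff n (P ^ k)).eval s))
      (Q := (coeff n P).comp (Polynomial.X + Polynomial.C s)) fun a => by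
        have := step1 a s
        rw [hsub, hcoeff] at this
        simpa [Polynomial.eval_finsetSum] using this
    have := congrArg (Polynomial.eval r) this
    rw [hsub, hcoeff]
    simpa [Polynomial.eval_finsetSum] using this
  · intro n
    simp only [hcoeff]
    exact (Polynomial.differentiable _).differentiableAt
  · intro s
    rw [hcoeff]
    simp [genericIterate, sum_range_succ, LinearMap.sub_apply, compOp_apply,
      subst_X (HasSubst.of_constantCoeff_zero' hf), hf1]

/-! ### One-parameter groups of matrices -/

/-- A homomorphism from `(ℂ, +)` to the units of a Banach algebra that is differentiable at `0`
is `s ↦ exp (s L)`: both `M` and `s ↦ exp (s L)` solve `M' = M L`. -/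
theorem oneParameterGroup_eq_exp {A : Type*} [NormedRing A] [NormedAlgebra ℂ A] [CompleteSpace A]
    {M : ℂ → A} {L : A} (hadd : ∀ r s, M (r + s) = M r * M s) (h0 : M 0 = 1)
    (hL : HasDerivAt M L 0) (s : ℂ) : M s = NormedSpace.exp (s • L) := by
  let _ : NormedAlgebra ℚ A := NormedAlgebra.restrictScalars ℚ ℂ A
  have hM : ∀ s, HasDerivAt M (M s * L) s := fun s => by
    have h := hL
    rw [← sub_self s] at h
    refine ((h.comp_sub_const s s).const_mul (M s)).congr_of_eventuallyEq
      (Filter.Eventually.of_forall fun t => ?_)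
    change M t = M s * M (t - s)
    rw [← hadd, add_sub_cancel]
  have hg : ∀ s, HasDerivAt (fun s => M s * NormedSpace.exp (s • (-L))) 0 s := fun s => by
    refine ((hM s).mul (hasDerivAt_exp_smul_const' (-L) s)).congr_deriv ?_
    simp [mul_assoc]
  have h := is_const_of_deriv_eq_zero (fun s => (hg s).differentiableAt)
    (fun s => (hg s).deriv) s 0
  simp only [h0, zero_smul, smul_neg, neg_zero, NormedSpace.exp_zero, mul_one] at h
  calc M s = M s * (NormedSpace.exp (-(s • L)) * NormedSpace.exp (s • L)) := by
        rw [← NormedSpace.exp_add_of_commute (Commute.neg_left (Commute.refl _)),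
          neg_add_cancel, NormedSpace.exp_zero, mul_one]
    _ = NormedSpace.exp (s • L) := by rw [← mul_assoc, h, one_mul]

attribute [local instance] Matrix.linftyOpNormedRing Matrix.linftyOpNormedAlgebra in
/-- The entrywise form of `oneParameterGroup_eq_exp` at `s = 1` for matrices. -/
theorem hasSum_entry_of_oneParameterGroup {ι : Type*} [Fintype ι] [DecidableEq ι]
    {M : ℂ → Matrix ι ι ℂ} {L : Matrix ι ι ℂ} (hadd : ∀ r s, M (r + s) = M r * M s)
    (h0 : M 0 = 1) (hL : ∀ i j, HasDerivAt (fun s => M s i j) (L i j) 0) (i j : ι) :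
    HasSum (fun m : ℕ => (m.factorial : ℂ)⁻¹ * (L ^ m) i j) (M 1 i j) := by
  have hL' : HasDerivAt M L 0 := by
    have e : M = fun s => ∑ i, ∑ j, M s i j • Matrix.single i j (1 : ℂ) := by
      funext s
      conv_lhs => rw [Matrix.matrix_eq_sum_single (M s)]
      simp [Matrix.smul_single]
    rw [e, Matrix.matrix_eq_sum_single L]
    refine HasDerivAt.fun_sum fun i _ => HasDerivAt.fun_sum fun j _ => ?_
    refine ((hL i j).smul_const (Matrix.single i j (1 : ℂ))).congr_deriv ?_
    simp [Matrix.smul_single]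
  have h1 := oneParameterGroup_eq_exp hadd h0 hL' 1
  rw [one_smul] at h1
  have h2 := NormedSpace.exp_series_hasSum_exp' (𝕂 := ℂ) L
  rw [← h1] at h2
  have hc : Continuous fun A : Matrix ι ι ℂ => A i j := continuous_id.matrix_elem i j
  exact h2.map (Matrix.entryAddMonoidHom (α := ℂ) i j) hc

/-! ### The matrix of composition with the iterates -/

/-- The series `f` can be cancelled on the right in `f^0 ∘ f = f`. -/
theorem IsFractionalIteration.zero {f : ℂ⟦X⟧} {F : ℂ → ℂ⟦X⟧} (hF : IsFractionalIteration f F)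
    (hf0 : constantCoeff f = 0) (hf1 : coeff 1 f ≠ 0) : F 0 = X := by
  obtain ⟨g, hg0, hfg, -⟩ := exists_compInverse hf0 hf1
  have h := hF.comp 0 1
  rw [zero_add, hF.one] at h
  have h2 := congrArg (PowerSeries.subst g) h
  rwa [subst_assoc hf0 hg0, hfg, X_subst] at h2

theorem IsFractionalIteration.hasDerivAt {f : ℂ⟦X⟧} {F : ℂ → ℂ⟦X⟧}
    (hF : IsFractionalIteration f F) (n : ℕ) :
    HasDerivAt (fun s => coeff n (F s)) (coeff n (itlog F)) 0 := by
  rw [itlog, coeff_mk]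
  exact (hF.differentiableAt_zero n).hasDerivAt

theorem constantCoeff_itlog {f : ℂ⟦X⟧} {F : ℂ → ℂ⟦X⟧} (hF : IsFractionalIteration f F) :
    constantCoeff (itlog F) = 0 := by
  have h : (fun s => coeff 0 (F s)) = fun _ => 0 := funext fun s => by
    rw [coeff_zero_eq_constantCoeff_apply, hF.constantCoeff_eq_zero]
  rw [← coeff_zero_eq_constantCoeff_apply, itlog, coeff_mk, h, deriv_const]

/-- The derivation `V(t) d/dt` applied to `t^k`. For `k = 0` the factor `k` makes the truncated
exponent `k - 1` harmless. -/
def vectorFieldPow (V : ℂ⟦X⟧) (k : ℕ) : ℂ⟦X⟧ := (k : ℂ⟦X⟧) * X ^ (k - 1) * V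

/-- The infinitesimal generator of `s ↦ (g ↦ g ∘ f^s)` is the derivation `itlog(f)(t) d/dt`. -/
theorem IsFractionalIteration.hasDerivAt_pow {f : ℂ⟦X⟧} {F : ℂ → ℂ⟦X⟧}
    (hF : IsFractionalIteration f F) (h0 : F 0 = X) (k n : ℕ) :
    HasDerivAt (fun s => coeff n (F s ^ k)) (coeff n (vectorFieldPow (itlog F) k)) 0 := by
  induction k generalizing n with
  | zero =>
    simp only [pow_zero, vectorFieldPow, Nat.cast_zero, zero_mul, map_zero]
    exact hasDerivAt_const _ _
  | succ k ih =>
    have e : vectorFieldPow (itlog F) (k + 1) =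
        vectorFieldPow (itlog F) k * F 0 + F 0 ^ k * itlog F := by
      rw [h0, vectorFieldPow, vectorFieldPow]
      cases k with
      | zero => simp
      | succ k => simp only [Nat.add_sub_cancel]; push_cast; ring
    simp only [pow_succ, coeff_mul, e, map_add]
    rw [← sum_add_distrib]
    exact HasDerivAt.fun_sum fun x _ => (ih x.1).mul (hF.hasDerivAt x.2)

/-- The matrix of `g ↦ g ∘ f` modulo `t^(N+1)`, with entries `[t^n] f^k`, is the exponential of the
matrix of `itlog(f)(t) d/dt`. -/
theorem IsFractionalIteration.hasSum_coeff_pow {f : ℂ⟦X⟧} {F : ℂ → ℂ⟦X⟧}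
    (hF : IsFractionalIteration f F) (h0 : F 0 = X) (N : ℕ) (k n : Fin (N + 1)) :
    HasSum (fun m : ℕ => (m.factorial : ℂ)⁻¹ *
      ((Matrix.of fun i j : Fin (N + 1) => coeff j (vectorFieldPow (itlog F) i)) ^ m) k n)
      (coeff n (f ^ (k : ℕ))) := by
  have := hasSum_entry_of_oneParameterGroup
    (M := fun s => Matrix.of fun i j : Fin (N + 1) => coeff j (F s ^ (i : ℕ)))
    (L := Matrix.of fun i j : Fin (N + 1) => coeff j (vectorFieldPow (itlog F) i))
    (fun r s => ?_) ?_ (fun i j => hF.hasDerivAt_pow h0 i j) k n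
  · simpa [hF.one] using this
  · ext i j
    have hs := hF.constantCoeff_eq_zero s
    rw [Matrix.mul_apply, Matrix.of_apply, ← hF.comp r s,
      ← subst_pow (HasSubst.of_constantCoeff_zero' hs), coeff_subst_eq_sum hs _ (Fin.is_le j)]
    simp only [Matrix.of_apply, smul_eq_mul]
    exact (Fin.sum_univ_eq_sum_range
      (fun k => coeff k (F r ^ (i : ℕ)) * coeff j (F s ^ k)) (N + 1)).symm
  · ext i j
    simp [h0, coeff_X_pow, Matrix.one_apply, Fin.ext_iff, eq_comm]

/-! ### The operators on polynomials -/

theorem coeff_evalD (V : ℂ⟦X⟧) {p : Polynomial ℂ} {N : ℕ} (hp : p.natDegree ≤ N) (k : ℕ) :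
    (k.factorial : ℂ) * (evalD V p).coeff k =
      ∑ n ∈ range (N + 1), coeff n (X ^ k * V) * (n.factorial * p.coeff n) := by
  have hD : evalD V p = ∑ j ∈ range (N + 1), coeff j V • Polynomial.derivative^[j] p :=
    sum_derivative_eq V p (by omega)
  have hext : ∑ n ∈ range (N + 1), coeff n (X ^ k * V) * (n.factorial * p.coeff n) =
      ∑ n ∈ range (k + (N + 1)), coeff n (X ^ k * V) * (n.factorial * p.coeff n) := by
    refine sum_subset (range_mono (by omega)) fun n _ hn => ?_
    rw [Polynomial.coeff_eq_zero_of_natDegree_lt (by simp at hn; omega), mul_zero, mul_zero]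
  rw [hext, sum_range_add, sum_eq_zero fun n hn => ?_, zero_add, hD, Polynomial.finsetSum_coeff,
    mul_sum]
  · refine sum_congr rfl fun j _ => ?_
    rw [Polynomial.coeff_smul, Polynomial.coeff_iterate_derivative, add_comm k j,
      coeff_X_pow_mul, add_comm j k, ← Nat.factorial_mul_descFactorial (Nat.le_add_left j k),
      Nat.add_sub_cancel, smul_eq_mul, nsmul_eq_mul]
    push_cast
    ring
  · rw [X_pow_dvd_iff.mp (dvd_mul_right _ _) n (by simpa using hn), zero_mul]

/-- In the basis `x^k / k!` the operator `𝐱 V(D)` has the matrix of the derivation `V(t) d/dt`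
in the basis `t^k`, up to transposition. -/
theorem coeff_mulX_evalD (V : ℂ⟦X⟧) {p : Polynomial ℂ} {N : ℕ} (hp : p.natDegree ≤ N) (k : ℕ) :
    (k.factorial : ℂ) * ((mulX * evalD V) p).coeff k =
      ∑ n ∈ range (N + 1), coeff n (vectorFieldPow V k) * (n.factorial * p.coeff n) := by
  rw [Module.End.mul_apply, mulX, LinearMap.mulLeft_apply]
  cases k with
  | zero => simp [vectorFieldPow]
  | succ k =>
    rw [Polynomial.coeff_X_mul, Nat.factorial_succ, Nat.cast_mul, mul_assoc, coeff_evalD V hp,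
      mul_sum]
    refine sum_congr rfl fun n _ => ?_
    have : vectorFieldPow V (k + 1) = ((k + 1 : ℕ) : ℂ) • (X ^ k * V) := by
      rw [vectorFieldPow, smul_eq_C_mul, map_natCast, mul_assoc, Nat.add_sub_cancel]
    rw [this, coeff_smul, smul_eq_mul, mul_assoc]

/-- Since `V(0) = 0`, the operator `V(D)` lowers degrees by at least one, while `𝐱` raises them by one. -/
theorem natDegree_mulX_evalD_le {V : ℂ⟦X⟧} (hV : constantCoeff V = 0) {p : Polynomial ℂ} {N : ℕ}
    (hp : p.natDegree ≤ N) : ((mulX * evalD V) p).natDegree ≤ N := by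
  rw [Polynomial.natDegree_le_iff_coeff_eq_zero]
  intro k hk
  have h := coeff_mulX_evalD V hp k
  rw [sum_eq_zero fun n hn => ?_] at h
  · exact (mul_eq_zero.mp h).resolve_left (Nat.cast_ne_zero.mpr k.factorial_ne_zero)
  · have : (X : ℂ⟦X⟧) ^ k ∣ vectorFieldPow V k := by
      obtain ⟨j, rfl⟩ : ∃ j, k = j + 1 := ⟨k - 1, by omega⟩
      rw [vectorFieldPow, mul_assoc, Nat.add_sub_cancel, pow_succ]
      exact (mul_dvd_mul_left _ (X_dvd_iff.mpr hV)).mul_left _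
    rw [X_pow_dvd_iff.mp this n (by simp at hn; omega), zero_mul]

theorem coeff_mulX_evalD_pow {V : ℂ⟦X⟧} (hV : constantCoeff V = 0) {N : ℕ} (m : ℕ)
    (p : Polynomial ℂ) (hp : p.natDegree ≤ N) (k : Fin (N + 1)) :
    ((k : ℕ).factorial : ℂ) * (((mulX * evalD V) ^ m) p).coeff k =
      ∑ n : Fin (N + 1), ((Matrix.of fun i j : Fin (N + 1) => coeff j (vectorFieldPow V i)) ^ m) k n
        * ((n : ℕ).factorial * p.coeff n) := by
  induction m generalizing p with
  | zero => simp [Matrix.one_apply]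
  | succ m ih =>
    rw [pow_succ, Module.End.mul_apply, ih _ (natDegree_mulX_evalD_le hV hp), pow_succ]
    simp only [Matrix.mul_apply, sum_mul, coeff_mulX_evalD V hp]
    rw [sum_comm]
    refine sum_congr rfl fun i _ => ?_
    rw [← Fin.sum_univ_eq_sum_range
      (fun n => coeff n (vectorFieldPow V i) * (n.factorial * p.coeff n)), mul_sum]
    simp only [Matrix.of_apply, mul_assoc]

theorem coeff_expXMul {f : ℂ⟦X⟧} (hf : constantCoeff f = 0) (n k : ℕ) :
    (k.factorial : ℂ) * (coeff n (expXMul f)).coeff k = coeff n (f ^ k) := by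
  have h0 : constantCoeff (C (Polynomial.X : Polynomial ℂ) * PowerSeries.map Polynomial.C f)
      = 0 := by
    rw [map_mul, ← coeff_zero_eq_constantCoeff_apply (PowerSeries.map _ f), coeff_map,
      coeff_zero_eq_constantCoeff_apply, hf, map_zero, mul_zero]
  have hterm : ∀ j, coeff n ((C (Polynomial.X : Polynomial ℂ) *
      PowerSeries.map Polynomial.C f) ^ j) = Polynomial.C (coeff n (f ^ j)) * Polynomial.X ^ j :=
    fun j => by rw [mul_pow, ← map_pow, ← map_pow, coeff_C_mul, coeff_map, mul_comm]
  rw [expXMul, coeff_subst_eq_sum h0 _ (le_max_left n k)]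
  simp only [hterm, Polynomial.finsetSum_coeff, Polynomial.coeff_smul, Polynomial.coeff_C_mul,
    Polynomial.coeff_X_pow, coeff_exp]
  rw [sum_eq_single k (fun j _ hj => by simp [hj.symm]) (fun h => by simp at h)]
  have : (k.factorial : ℂ) ≠ 0 := Nat.cast_ne_zero.mpr k.factorial_ne_zero
  simp
  field_simp

/-- In the basis `x^k / k!` the umbral operator of `f` has the matrix `[t^n] f^k` of the composition
operator `g ↦ g ∘ f`, up to transposition. -/
theorem IsUmbralOperator.coeff_apply {f : ℂ⟦X⟧} (hf : constantCoeff f = 0)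
    {φ : Module.End ℂ (Polynomial ℂ)} (hφ : IsUmbralOperator f φ) {p : Polynomial ℂ} {N : ℕ}
    (hp : p.natDegree ≤ N) (k : ℕ) :
    (k.factorial : ℂ) * (φ p).coeff k =
      ∑ n ∈ range (N + 1), coeff n (f ^ k) * (n.factorial * p.coeff n) := by
  have hmon : ∀ n, (k.factorial : ℂ) * (φ (Polynomial.X ^ n)).coeff k =
      n.factorial * coeff n (f ^ k) := fun n => by
    have h : coeff n (genFun φ) = coeff n (expXMul f) := by rw [show genFun φ = expXMul f from hφ]
    rw [← coeff_expXMul hf, ← h, genFun, coeff_mk, Polynomial.coeff_smul, smul_eq_mul]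
    have : (n.factorial : ℂ) ≠ 0 := Nat.cast_ne_zero.mpr n.factorial_ne_zero
    field_simp
  conv_lhs => rw [p.as_sum_range' (N + 1) (by omega)]
  simp only [map_sum, ← Polynomial.smul_X_eq_monomial, map_smul, Polynomial.finsetSum_coeff,
    Polynomial.coeff_smul, smul_eq_mul, mul_sum]
  refine sum_congr rfl fun n _ => ?_
  linear_combination p.coeff n * hmon n

/-- The degree filtration reduces the exponential formula to that of finite matrices. The truncation
at `N = max (deg p) k` contains both `p` and the coefficient of `x^k`. -/
theorem IsUmbralOperator.isOperatorExp {f : ℂ⟦X⟧} (hf0 : constantCoeff f = 0)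
    (hf1 : coeff 1 f ≠ 0) {F : ℂ → ℂ⟦X⟧} {φ : Module.End ℂ (Polynomial ℂ)}
    (hF : IsFractionalIteration f F) (hφ : IsUmbralOperator f φ) :
    IsOperatorExp (mulX * evalD (itlog F)) φ := by
  intro p k
  set N := max p.natDegree k with hN
  have hp : p.natDegree ≤ N := le_max_left _ _
  have hk : (k.factorial : ℂ) ≠ 0 := Nat.cast_ne_zero.mpr k.factorial_ne_zero
  let k' : Fin (N + 1) := ⟨k, Nat.lt_succ_of_le (le_max_right _ _)⟩
  have h1 := hasSum_sum (s := univ) fun n _ =>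
    (hF.hasSum_coeff_pow (hF.zero hf0 hf1) N k' n).mul_right ((n : ℕ).factorial * p.coeff n : ℂ)
  have h2 := h1.mul_left (k.factorial : ℂ)⁻¹
  have hterm : ∀ m : ℕ, (((m.factorial : ℂ)⁻¹) • ((mulX * evalD (itlog F)) ^ m) p).coeff k =
      (k.factorial : ℂ)⁻¹ * ∑ n : Fin (N + 1), (m.factorial : ℂ)⁻¹ *
        ((Matrix.of fun i j : Fin (N + 1) => coeff j (vectorFieldPow (itlog F) i)) ^ m) k' n *
          ((n : ℕ).factorial * p.coeff n) := fun m => by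
    have h3 := coeff_mulX_evalD_pow (constantCoeff_itlog hF) m p hp k'
    simp only [mul_assoc]
    rw [← mul_sum, ← h3, Polynomial.coeff_smul, smul_eq_mul]
    simp only [k']
    field_simp
  have hval : (φ p).coeff k = (k.factorial : ℂ)⁻¹ * ∑ n : Fin (N + 1),
      coeff n (f ^ (k' : ℕ)) * ((n : ℕ).factorial * p.coeff n) := by
    rw [Fin.sum_univ_eq_sum_range
      (fun n => coeff n (f ^ (k' : ℕ)) * (n.factorial * p.coeff n)), ← hφ.coeff_apply hf0 hp k',
      inv_mul_cancel_left₀ hk]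
  rw [hval, funext hterm]
  exact h2

end

end UmbralIteration

theorem mainTheorem1 (f : PowerSeries ℂ) (hf0 : PowerSeries.constantCoeff f = 0)
    (hf1 : PowerSeries.coeff 1 f ≠ 0) :
    (∀ l : ℂ, Complex.exp l = PowerSeries.coeff 1 f →
      (l = 0 ∨ ∀ n : ℕ, 1 ≤ n → (PowerSeries.coeff 1 f) ^ n ≠ 1) →
      ∃! F : ℂ → PowerSeries ℂ, UmbralIteration.IsFractionalIteration f F ∧
        ∀ s : ℂ, PowerSeries.coeff 1 (F s) = Complex.exp (l * s)) ∧
    (∀ (F : ℂ → PowerSeries ℂ) (φ : Module.End ℂ (Polynomial ℂ)),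
      UmbralIteration.IsFractionalIteration f F →
      UmbralIteration.IsUmbralOperator f φ →
      UmbralIteration.IsOperatorExp
        (UmbralIteration.mulX * UmbralIteration.evalD (UmbralIteration.itlog F)) φ) := by
  refine ⟨fun l hl hroot => ?_, fun F φ hF hφ => hφ.isOperatorExp hf0 hf1 hF⟩
  obtain ⟨F, hF, hF1⟩ : ∃ F : ℂ → PowerSeries ℂ, UmbralIteration.IsFractionalIteration f F ∧
      ∀ s, PowerSeries.coeff 1 (F s) = Complex.exp (l * s) := by
    rcases hroot with rfl | hroot
    · rw [Complex.exp_zero] at hl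
      simpa using UmbralIteration.exists_isFractionalIteration_of_coeff_one_eq_one hf0 hl.symm
    · obtain ⟨σ, hσ0, hσ1, hσ⟩ := UmbralIteration.exists_linearization hf0 hf1 hroot
      rw [← hl] at hσ
      exact UmbralIteration.exists_isFractionalIteration_of_linearization hσ0 hσ1 hf0 hσ
  rw [← hl] at hroot
  exact ⟨F, ⟨hF, hF1⟩, fun G hG => hG.1.eq_of_coeff_one_eq hroot hF hG.2 hF1⟩
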